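/- **Theorem 7.5 (existence of a solution of the outer problem).** *Setting.* Let $E$ (states) and $A$ (actions) be Borel spaces, i.e. Borel subsets of Polish spaces, and let $Z_1,Z_2,\dots$ be independent random elements of a measurable space $\mathcal Z$, defined on a probability space $(\Omega,\mathcal A,\mathbb P)$. For each stage $n=0,1,2,\dots$ let $D_n\subseteq E\times A$ be a measurable set that contains the graph of a measurable map $E\to A$, with sections $D_n(x)=\{a:(x,a)\in D_n\}$; let $T_n:D_n\times\mathcal Z\to E$ be measurable, and let $c_n:D_n\times E\to[0,\infty)$ be a one-stage cost. Let $c_N:E\to[0,\infty)$ denote the terminal cost at a finite horizon $N$, and let $\beta>0$. Write $\widehat E=E\times[0,\infty)\times(0,\infty)$. A Markov policy is a sequence $\pi=(d_0,d_1,\dots)$ of measurable maps $d_n:\widehat E\to A$ with $d_n(x,s,t)\in D_n(x)$. Started at $(X_0,s_0,t_0)=(x,0,1)$ it generates $$a_n=d_n(X_n,s_n,t_n),\quad X_{n+1}=T_n(X_n,a_n,Z_{n+1}),\quad s_{n+1}=s_n+t_n\,c_n(X_n,a_n,X_{n+1}),\quad t_{n+1}=\beta t_n .$$ Let $\phi:[0,1]\to[0,\infty)$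 be increasing with $\int_0^1\phi(u)\,du=1$, let $\bar\rho\ge 0$, and let $\mathcal G$ be the set of increasing convex $\phi(1)$-Lipschitz functions $g:\mathbb R\to\mathbb R$ with $0\le g(x)\le\phi(1)x^++\bar\rho$ for all $x\in\mathbb R$. Let $g^*(y)=\sup_{s\in\mathbb R}\{sy-g(s)\}\in[-\infty,\infty]$ be the convex conjugate of $g$. *Assumption 3.1.* For each stage $n$ that occurs: (i) the sets $D_n(x)$ are compact, and $x\mapsto D_n(x)$ is upper semicontinuous, i.e. if $x_k\to x$ and $a_k\in D_n(x_k)$ for all $k$, then $(a_k)$ has an accumulation point in $D_n(x)$; (ii) $(x,a)\mapsto T_n(x,a,z)$ is continuous for every $z\in\mathcal Z$; (iii) $c_n$ is lower semicontinuous, and so is the terminal cost $c_N$. *Claim.* Fix an initial state $x\in E$. In each of the following two cases the outer problem $$\inf_{g\in\mathcal G}\Big\{J(g)+\int_0^1 g^*(\phi(u))\,du\Big\}$$ has a minimizer, i.e. there is $g_0\in\mathcal G$ whose objective value in $(-\infty,\infty]$ is at most that of every $g\in\mathcal G$. 1. (Finite horizon $N$.) Assumption 3.1 holds for the stages $n<N$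 and for the terminal cost, and $$J(g)=\inf_\pi\ \mathbb E\Big[g\Big(\sum_{k=0}^{N-1}\beta^k c_k(X_k,a_k,X_{k+1})+\beta^N c_N(X_N)\Big)\Big].$$ 2. (Infinite horizon.) The model is stationary: $D_n=D$, $T_n=T$, $c_n=c$ do not depend on $n$, the $Z_n$ are identically distributed, and there is no terminal cost; Assumption 3.1 holds, and $$J(g)=\inf_\pi\ \mathbb E\Big[g\Big(\sum_{k=0}^{\infty}\beta^k c(X_k,a_k,X_{k+1})\Big)\Big],\qquad g(\infty):=\lim_{r\to\infty}g(r).$$ Both infima run over all Markov policies $\pi$, and $J(g)$ takes values in $[0,\infty]$. -/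

import Mathlib

open MeasureTheory ProbabilityTheory Topology Filter
open scoped NNReal ENNReal unitInterval

noncomputable section

namespace SpectralMDP

/-- The data of one stage of the decision model: the set `D` of admissible state-action pairs, the
transition function `T : D × 𝒵 → E` and the one-stage cost `c : D × E → [0, ∞)`. A non-stationary
model is a sequence of stages, a stationary model is a constant sequence. -/
structure Stage (E A 𝒵 : Type*) [MeasurableSpace E] [MeasurableSpace A] [MeasurableSpace 𝒵] where
  D : Set (E × A)
  measurableSet_D : MeasurableSet D
  exists_selector : ∃ f : E → A, Measurable f ∧ ∀ x, (x, f x) ∈ D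
  T : D × 𝒵 → E
  measurable_T : Measurable T
  c : D × E → ℝ≥0

/-- The continuity and compactness assumption on one stage: the sections `D(x)` are compact and
upper semicontinuous in `x`, the transition function is continuous in `(x, a)`, and the one-stage
cost is lower semicontinuous. -/
structure Stage.Regular {E A 𝒵 : Type*} [MeasurableSpace E] [MeasurableSpace A]
    [MeasurableSpace 𝒵] [TopologicalSpace E] [TopologicalSpace A] (S : Stage E A 𝒵) : Prop where
  isCompact_section : ∀ x : E, IsCompact {a : A | (x, a) ∈ S.D}
  upperSemicontinuous : ∀ (x : E) (xs : ℕ → E) (as : ℕ → A), Tendsto xs atTop (𝓝 x) →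
    (∀ k, (xs k, as k) ∈ S.D) → ∃ a : A, (x, a) ∈ S.D ∧ MapClusterPt a atTop as
  continuous_T : ∀ z : 𝒵, Continuous fun p : S.D => S.T (p, z)
  lowerSemicontinuous_c : LowerSemicontinuous S.c

/-- The extended state space `E × [0, ∞) × (0, ∞)`, with elements `(x, s, t)`: state, accumulated
cost and current discount factor. -/
abbrev ExtState (E : Type*) := E × ℝ≥0 × {t : ℝ≥0 // 0 < t}

/-- A Markov decision rule on the extended state space: a measurable map `d` with
`d(x, s, t) ∈ D(x)`. -/
def MarkovRule {E A 𝒵 : Type*} [MeasurableSpace E] [MeasurableSpace A] [MeasurableSpace 𝒵]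
    (S : Stage E A 𝒵) :=
  {d : ExtState E → A // Measurable d ∧ ∀ y, (y.1, d y) ∈ S.D}

/-- A Markov policy on the extended state space. With horizon `N`, only the rules at the times
`n < N` enter. -/
def MarkovPolicy {E A 𝒵 : Type*} [MeasurableSpace E] [MeasurableSpace A] [MeasurableSpace 𝒵]
    (M : ℕ → Stage E A 𝒵) :=
  ∀ n, MarkovRule (M n)

section Dynamics

variable {E A 𝒵 Ω : Type*} [MeasurableSpace E] [MeasurableSpace A] [MeasurableSpace 𝒵]

/-- The admissible state-action pair `(x, d(x, s, t))` chosen by a Markov rule. -/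
def MarkovRule.pair {S : Stage E A 𝒵} (d : MarkovRule S) (y : ExtState E) : S.D :=
  ⟨(y.1, d.1 y), d.2.2 y⟩

/-- The extended transition `(x, s, t) ↦ (x', s + t c(x, a, x'), β t)` with `a = d(x, s, t)` and
`x' = T(x, a, z)`. -/
def Stage.step (S : Stage E A 𝒵) (β : {t : ℝ≥0 // 0 < t}) (d : MarkovRule S) (y : ExtState E)
    (z : 𝒵) : ExtState E :=
  (S.T (d.pair y, z),
    y.2.1 + y.2.2.1 * S.c (d.pair y, S.T (d.pair y, z)),
    ⟨β.1 * y.2.2.1, mul_pos β.2 y.2.2.2⟩)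

/-- The extended state at time `n`, started at `y` and run under the Markov policy `π`. The
disturbance `Z n` acts between the times `n` and `n + 1`. -/
def traj (M : ℕ → Stage E A 𝒵) (β : {t : ℝ≥0 // 0 < t}) (Z : ℕ → Ω → 𝒵) (π : MarkovPolicy M)
    (y : ExtState E) : ℕ → Ω → ExtState E
  | 0, _ => y
  | n + 1, ω => (M n).step β (π n) (traj M β Z π y n ω) (Z n ω)

/-- The undiscounted cost `c_k(X_k, d_k(X_k, s_k, t_k), X_{k+1})` of stage `k`. -/
def stageCost (M : ℕ → Stage E A 𝒵) (β : {t : ℝ≥0 // 0 < t}) (Z : ℕ → Ω → 𝒵)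
    (π : MarkovPolicy M) (y : ExtState E) (k : ℕ) (ω : Ω) : ℝ≥0 :=
  (M k).c ((π k).pair (traj M β Z π y k ω), (traj M β Z π y (k + 1) ω).1)

variable [MeasurableSpace Ω]

/-- The value function of the inner problem with horizon `N`: the infimum over all Markov policies
of `𝔼[g(s + t (∑_{k<N} β^k c_k + β^N c_N(X_N)))]`. It is used for `g ≥ 0` only, so that the
expectation exists in `[0, ∞]`. -/
def valueFin (P : Measure Ω) (M : ℕ → Stage E A 𝒵) (cN : E → ℝ≥0) (β : {t : ℝ≥0 // 0 < t})
    (Z : ℕ → Ω → 𝒵) (N : ℕ) (g : ℝ → ℝ) (y : ExtState E) : ℝ≥0∞ :=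
  ⨅ π : MarkovPolicy M, ∫⁻ ω, ENNReal.ofReal (g ((y.2.1 + y.2.2.1 *
    (∑ k ∈ Finset.range N, β.1 ^ k * stageCost M β Z π y k ω
      + β.1 ^ N * cN (traj M β Z π y N ω).1) : ℝ≥0) : ℝ)) ∂P

/-- The extension of a nonnegative increasing continuous function `g` to `[0, ∞]`, with
`g(∞) = lim_{r → ∞} g(r)`. -/
def extend (g : ℝ → ℝ) (y : ℝ≥0∞) : ℝ≥0∞ :=
  ⨆ (r : ℝ≥0) (_ : (r : ℝ≥0∞) ≤ y), ENNReal.ofReal (g r)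

/-- The value function of the inner problem with infinite horizon for the stationary model with
stage `S`: the infimum over all Markov policies of `𝔼[g(s + t ∑_{k≥0} β^k c(X_k, a_k, X_{k+1}))]`.
The total cost may be infinite, in which case `g` is evaluated by its limit. -/
def valueInf (P : Measure Ω) (S : Stage E A 𝒵) (β : {t : ℝ≥0 // 0 < t}) (Z : ℕ → Ω → 𝒵)
    (g : ℝ → ℝ) (y : ExtState E) : ℝ≥0∞ :=
  ⨅ π : MarkovPolicy (fun _ : ℕ => S), ∫⁻ ω, extend g ((y.2.1 : ℝ≥0∞) + (y.2.2.1 : ℝ≥0∞) *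
    ∑' k : ℕ, ((β.1 ^ k * stageCost (fun _ : ℕ => S) β Z π y k ω : ℝ≥0) : ℝ≥0∞)) ∂P

end Dynamics

/-- A spectrum: an increasing function `φ : [0, 1] → [0, ∞)` with integral one. -/
structure IsSpectrum (φ : I → ℝ≥0) : Prop where
  monotone : Monotone φ
  lintegral_eq_one : ∫⁻ u, (φ u : ℝ≥0∞) = 1

/-- The increasing convex `L`-Lipschitz functions with `0 ≤ g(x) ≤ L x⁺ + ρ`. -/
def feasible (L ρ : ℝ≥0) : Set (ℝ → ℝ) :=
  {g | Monotone g ∧ ConvexOn ℝ Set.univ g ∧ LipschitzWith L g ∧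
    ∀ x, 0 ≤ g x ∧ g x ≤ L * max x 0 + ρ}

/-- The convex conjugate `g*(y) = sup_s (s y - g(s))`, with values in `[-∞, ∞]`. -/
def conjugate (g : ℝ → ℝ) (y : ℝ) : EReal :=
  ⨆ s : ℝ, ((s * y - g s : ℝ) : EReal)

/-- The integral of an extended-real-valued function over `[0, 1]`: the integral of the positive
part minus the integral of the negative part. -/
def integral01 (f : I → EReal) : EReal :=
  ((∫⁻ u, (f u).toENNReal : ℝ≥0∞) : EReal) - ((∫⁻ u, (-f u).toENNReal : ℝ≥0∞) : EReal)

/-- The objective `J(g) + ∫_0^1 g*(φ(u)) du` of the outer problem. -/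
def outerObjective (J : (ℝ → ℝ) → ℝ≥0∞) (φ : I → ℝ≥0) (g : ℝ → ℝ) : EReal :=
  (J g : EReal) + integral01 fun u => conjugate g (φ u)

end SpectralMDP

end

namespace SpectralMDP

/-! ### Lower semicontinuity and compactness tools -/

/-! A lower semicontinuous function on a compact space attains its minimum. The feasible functions
share a Lipschitz constant and pointwise bounds, so by Arzelà–Ascoli they are compact for locally
uniform convergence (`compactSpace_feasible`). It remains to see that both terms of the objective
are lower semicontinuous in `g`.

For `J`, treat `g` as a parameter `θ` of dynamic programming. The terminal value `g(s + t c_N(x))`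
is jointly lower semicontinuous in `θ` and the extended state, and increasing in `s`. The Bellman
operator preserves this pair of properties (`SemicontinuousMonotone.bellman`): monotonicity in `s`
absorbs costs that are only lower semicontinuous, Fatou handles the expectation, and compact, upper
semicontinuous action sets handle the infimum. Measurable selection of minimizers identifies `J`
with the iterates (`valueFin_eq_backward`). With infinite horizon the iterates increase; compactness
lets the supremum pass through the infimum over actions (`bellman_iSup_le`), so `J` is their
supremum (`valueInf_eq_iSup`).

For the penalty, `g*(y)` is a supremum of functions continuous in `g`, and `g* ≥ -ρ`, so Fatou
applies after a shift by `ρ` (`lowerSemicontinuous_lintegral_conjugate`). -/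

/-- Fatou's lemma along the neighbourhood filter, which first countability makes countably
generated. -/
theorem lowerSemicontinuous_lintegral {X 𝒵 : Type*} [TopologicalSpace X]
    [FirstCountableTopology X] [MeasurableSpace 𝒵] (μ : Measure 𝒵) {f : X → 𝒵 → ℝ≥0∞}
    (hf : ∀ z, LowerSemicontinuous fun x => f x z) (hm : ∀ x, Measurable (f x)) :
    LowerSemicontinuous fun x => ∫⁻ z, f x z ∂μ := by
  rw [lowerSemicontinuous_iff_le_liminf]
  intro x
  exact (lintegral_mono fun z => (hf z).lowerSemicontinuousAt x |>.le_liminf).trans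
    (lintegral_liminf_le hm)

/-- Extending a lower semicontinuous function on a closed set by `⊤` keeps it lower
semicontinuous. -/
theorem lowerSemicontinuous_iInf_mem {X : Type*} [TopologicalSpace X] {C : Set X}
    (hC : IsClosed C) {f : C → ℝ≥0∞} (hf : LowerSemicontinuous f) :
    LowerSemicontinuous fun x => ⨅ h : x ∈ C, f ⟨x, h⟩ := by
  rw [lowerSemicontinuous_iff_isClosed_preimage]
  intro r
  -- At level `⊤` the sublevel set is all of `X`, not just a subset of `C`.
  rcases eq_or_ne r ⊤ with rfl | hr
  · simp
  · have : (fun x => ⨅ h : x ∈ C, f ⟨x, h⟩) ⁻¹' Set.Iic r = Subtype.val '' (f ⁻¹' Set.Iic r) := by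
      ext x
      by_cases hx : x ∈ C <;> simp [hx, hr]
    rw [this]
    exact hC.isClosedEmbedding_subtypeVal.isClosedMap _ (hf.isClosed_preimage r)

/-- A relation is sequentially proper over its first coordinate if every sequence of second
coordinates over a convergent sequence of first coordinates has a convergent subsequence with
limit in the relation. -/
def SeqProper {X A : Type*} [TopologicalSpace X] [TopologicalSpace A] (R : Set (X × A)) : Prop :=
  ∀ (x : X) (xs : ℕ → X) (as : ℕ → A), Tendsto xs atTop (𝓝 x) → (∀ k, (xs k, as k) ∈ R) →
    ∃ (a : A) (ψ : ℕ → ℕ), StrictMono ψ ∧ (x, a) ∈ R ∧ Tendsto (as ∘ ψ) atTop (𝓝 a)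

namespace SeqProper

variable {X Y A : Type*} [TopologicalSpace X] [TopologicalSpace Y] [TopologicalSpace A]

theorem preimage {R : Set (X × A)} (hR : SeqProper R) {p : Y → X} (hp : Continuous p) :
    SeqProper {q : Y × A | (p q.1, q.2) ∈ R} := fun y ys as hys has =>
  hR (p y) (p ∘ ys) as ((hp.tendsto y).comp hys) has

/-- Projection along a proper relation is a closed map. This yields both semicontinuity of infima
over actions and measurability of the hitting sets. -/
theorem isClosed_image [SequentialSpace X] {R C : Set (X × A)} (hR : SeqProper R)
    (hC : IsClosed C) : IsClosed {x | ∃ a, (x, a) ∈ R ∧ (x, a) ∈ C} := by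
  refine IsSeqClosed.isClosed fun xs x hxs hx => ?_
  choose as hasR hasC using hxs
  obtain ⟨a, ψ, hψ, haR, ha⟩ := hR x xs as hx hasR
  exact ⟨a, haR, hC.mem_of_tendsto ((hx.comp hψ.tendsto_atTop).prodMk_nhds ha)
    (Eventually.of_forall fun k => hasC (ψ k))⟩

theorem isClosed [T2Space A] [SequentialSpace (X × A)] {R : Set (X × A)} (hR : SeqProper R) :
    IsClosed R := by
  refine IsSeqClosed.isClosed fun ps p hps hp => ?_
  obtain ⟨a, ψ, hψ, haR, ha⟩ := hR p.1 (fun k => (ps k).1) (fun k => (ps k).2)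
    ((continuous_fst.tendsto p).comp hp) hps
  have : a = p.2 := tendsto_nhds_unique ha
    ((((continuous_snd.tendsto p).comp hp)).comp hψ.tendsto_atTop)
  rwa [this] at haR

end SeqProper

/-! ### Measurable selection of minimizers -/

/-- The minimizers of `H y` over `K y`. -/
def argminOn {Y A : Type*} (K : Y → Set A) (H : Y → A → ℝ≥0∞) (y : Y) : Set A :=
  {a ∈ K y | ∀ b ∈ K y, H y a ≤ H y b}

/-- A multifunction with nonempty compact values that hits closed sets measurably. -/
structure CompactMeasurable {Y A : Type*} [MeasurableSpace Y] [TopologicalSpace A]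
    (K : Y → Set A) : Prop where
  nonempty : ∀ y, (K y).Nonempty
  isCompact : ∀ y, IsCompact (K y)
  measurableSet_hit : ∀ F, IsClosed F → MeasurableSet {y | ∃ a ∈ K y, a ∈ F}

section Selection

variable {Y A : Type*} [MeasurableSpace Y] [TopologicalSpace A]

/-- A minimizer lies in `F` exactly when `K y ∩ F` is nonempty and no level from a countable dense
set is reached on `K y` without being reached on `K y ∩ F`. Otherwise a dense level would separate
the two minima. -/
theorem CompactMeasurable.argminOn {K : Y → Set A} (hK : CompactMeasurable K)
    {H : Y → A → ℝ≥0∞} (hH : ∀ y, LowerSemicontinuous (H y))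
    (hm : ∀ F, IsClosed F → ∀ r, MeasurableSet {y | ∃ a ∈ K y, a ∈ F ∧ H y a ≤ r}) :
    CompactMeasurable (argminOn K H) where
  nonempty y := by
    obtain ⟨a, ha, hmin⟩ := ((hH y).lowerSemicontinuousOn (K y)).exists_isMinOn (hK.nonempty y)
      (hK.isCompact y)
    exact ⟨a, ha, fun b hb => hmin hb⟩
  isCompact y := by
    have : SpectralMDP.argminOn K H y = K y ∩ ⋂ b ∈ K y, H y ⁻¹' Set.Iic (H y b) := by
      ext a; simp [SpectralMDP.argminOn]
    rw [this]
    exact (hK.isCompact y).inter_right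
      (isClosed_biInter fun b _ => (hH y).isClosed_preimage _)
  measurableSet_hit F hF := by
    obtain ⟨s, hs, hsd⟩ := TopologicalSpace.exists_countable_dense ℝ≥0∞
    have key : {y | ∃ a ∈ SpectralMDP.argminOn K H y, a ∈ F} =
        {y | ∃ a ∈ K y, a ∈ F} ∩ ⋂ r ∈ s, ({y | ∃ a ∈ K y, a ∈ Set.univ ∧ H y a ≤ r}ᶜ ∪
          {y | ∃ a ∈ K y, a ∈ F ∧ H y a ≤ r}) := by
      ext y
      simp only [Set.mem_inter_iff, Set.mem_iInter, Set.mem_union, Set.mem_compl_iff,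
        Set.mem_ofPred_eq, Set.mem_univ, true_and]
      constructor
      · rintro ⟨a, ⟨haK, hmin⟩, haF⟩
        refine ⟨⟨a, haK, haF⟩, fun r _ => ?_⟩
        by_cases h : ∃ b ∈ K y, H y b ≤ r
        · obtain ⟨b, hb, hbr⟩ := h
          exact Or.inr ⟨a, haK, haF, (hmin b hb).trans hbr⟩
        · exact Or.inl h
      · rintro ⟨⟨a₀, ha₀, ha₀F⟩, h⟩
        obtain ⟨a, ⟨haK, haF⟩, hmin⟩ := ((hH y).lowerSemicontinuousOn (K y ∩ F)).exists_isMinOn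
          (Set.nonempty_of_mem (Set.mem_inter ha₀ ha₀F)) ((hK.isCompact y).inter_right hF)
        refine ⟨a, ⟨haK, fun b hb => ?_⟩, haF⟩
        by_contra! hlt
        obtain ⟨r, hr, hbr, hra⟩ := hsd.exists_between hlt
        rcases h r hr with h | ⟨a', ha', ha'F, ha'r⟩
        · exact h ⟨b, hb, hbr.le⟩
        · exact absurd ((hmin ⟨ha', ha'F⟩ : H y a ≤ H y a').trans ha'r) (not_le.mpr hra)
    rw [key]
    exact (hK.measurableSet_hit F hF).inter (MeasurableSet.biInter hs fun r _ =>
      (hm _ isClosed_univ r).compl.union (hm F hF r))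

/-- A multifunction with nonempty compact values that hits closed sets measurably has a measurable
selector: minimize successively the distances to a dense sequence. -/
theorem CompactMeasurable.exists_selector [TopologicalSpace.MetrizableSpace A]
    [SecondCountableTopology A] [MeasurableSpace A] [BorelSpace A] {K : Y → Set A}
    (hK : CompactMeasurable K) : ∃ f : Y → A, Measurable f ∧ ∀ y, f y ∈ K y := by
  let := TopologicalSpace.metrizableSpaceMetric A
  rcases isEmpty_or_nonempty Y with hY | ⟨⟨y₀⟩⟩
  · exact ⟨fun y => hY.elim y, measurable_of_empty _, fun y => hY.elim y⟩
  have : Nonempty A := ⟨(hK.nonempty y₀).some⟩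
  let e : ℕ → Y → A → ℝ≥0∞ := fun i _ a => edist a (TopologicalSpace.denseSeq A i)
  have he : ∀ i y, Continuous (e i y) := fun i y => continuous_id.edist continuous_const
  let L : ℕ → Y → Set A := fun n => Nat.rec K (fun i Ki => SpectralMDP.argminOn Ki (e i)) n
  have hLs : ∀ i, L (i + 1) = SpectralMDP.argminOn (L i) (e i) := fun i => rfl
  have hL : ∀ i, CompactMeasurable (L i) := by
    intro i
    induction i with
    | zero => exact hK
    | succ i ih =>
      rw [hLs]
      refine ih.argminOn (fun y => (he i y).lowerSemicontinuous) fun F hF r => ?_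
      exact ih.measurableSet_hit (F ∩ {a | edist a (TopologicalSpace.denseSeq A i) ≤ r})
        (hF.inter (isClosed_le (continuous_id.edist continuous_const) continuous_const))
  have hsub : ∀ i y, L (i + 1) y ⊆ L i y := fun i y a ha => ha.1
  -- Cantor's intersection theorem for the decreasing compact sets `L i y`.
  have hne : ∀ (F : Set A), IsClosed F → ∀ y, (∀ i, ∃ a ∈ L i y, a ∈ F) →
      (⋂ i, L i y ∩ F).Nonempty := fun F hF y h =>
    IsCompact.nonempty_iInter_of_sequence_nonempty_isCompact_isClosed _
      (fun i => Set.inter_subset_inter_left _ (hsub i y)) h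
      (((hL 0).isCompact y).inter_right hF) fun i => ((hL i).isCompact y).isClosed.inter hF
  -- Two points that survive every minimization have the same distance to each point of a dense
  -- sequence, hence coincide.
  have huniq : ∀ y a b, (∀ i, a ∈ L i y) → (∀ i, b ∈ L i y) → a = b := by
    intro y a b ha hb
    have hd : ∀ i, edist a (TopologicalSpace.denseSeq A i)
        = edist b (TopologicalSpace.denseSeq A i) := fun i =>
      le_antisymm ((ha (i + 1)).2 b (hb i)) ((hb (i + 1)).2 a (ha i))
    have : (fun x => edist a x) = fun x => edist b x := by
      refine Continuous.ext_on (TopologicalSpace.denseRange_denseSeq A)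
        (continuous_const.edist continuous_id) (continuous_const.edist continuous_id) ?_
      rintro _ ⟨i, rfl⟩
      exact hd i
    have h := congrFun this b
    simpa using h
  have hex : ∀ y, ∃ a, ∀ i, a ∈ L i y := fun y => by
    obtain ⟨a, ha⟩ := hne Set.univ isClosed_univ y fun i =>
      ((hL i).nonempty y).imp fun a h => ⟨h, trivial⟩
    exact ⟨a, fun i => (Set.mem_iInter.mp ha i).1⟩
  choose f hf using hex
  refine ⟨f, measurable_of_isClosed fun F hF => ?_, fun y => hf y 0⟩
  have : f ⁻¹' F = ⋂ i, {y | ∃ a ∈ L i y, a ∈ F} := by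
    ext y
    simp only [Set.mem_preimage, Set.mem_iInter, Set.mem_ofPred_eq]
    refine ⟨fun h i => ⟨f y, hf y i, h⟩, fun h => ?_⟩
    obtain ⟨a, ha⟩ := hne F hF y h
    have ha := Set.mem_iInter.mp ha
    rw [huniq y (f y) a (hf y) fun i => (ha i).1]
    exact (ha 0).2
  rw [this]
  exact MeasurableSet.iInter fun i => (hL i).measurableSet_hit F hF

end Selection

end SpectralMDP

noncomputable section

namespace SpectralMDP

/-- Near `x₀` replace `c` by `min c (c x₀)`, which converges to `c x₀`. Semicontinuity of `F`
applies to this truncation, and monotonicity of `F` restores `c`. -/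
theorem lowerSemicontinuous_add_mul {X : Type*} [TopologicalSpace X] {F : X × ℝ≥0 → ℝ≥0∞}
    (hF : LowerSemicontinuous F) (hmono : ∀ x, Monotone fun r => F (x, r)) {s t c : X → ℝ≥0}
    (hs : Continuous s) (ht : Continuous t) (hc : LowerSemicontinuous c) :
    LowerSemicontinuous fun x => F (x, s x + t x * c x) := by
  intro x₀ r hr
  have hmin : Tendsto (fun x => min (c x) (c x₀)) (𝓝 x₀) (𝓝 (c x₀)) := by
    refine tendsto_order.mpr ⟨fun a ha => ?_, fun a ha => ?_⟩
    · filter_upwards [hc x₀ a ha] with x hx using lt_min hx ha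
    · exact Eventually.of_forall fun x => (min_le_right _ _).trans_lt ha
  have hlim := (tendsto_id (x := 𝓝 x₀)).prodMk_nhds ((hs.tendsto x₀).add ((ht.tendsto x₀).mul hmin))
  filter_upwards [hlim.eventually (hF _ r hr)] with x hx
  refine lt_of_lt_of_le hx (hmono _ ?_)
  gcongr
  exact min_le_left _ _

/-! ### The Bellman operator -/

section SemicontinuousMonotone

variable {E Θ : Type*} [TopologicalSpace E] [TopologicalSpace Θ]

/-- A family of functions on the extended state space that is jointly lower semicontinuous in the
parameter and the state, and increasing in the accumulated cost. -/
structure SemicontinuousMonotone (v : Θ → ExtState E → ℝ≥0∞) : Prop where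
  lsc : LowerSemicontinuous fun q : Θ × ExtState E => v q.1 q.2
  mono : ∀ θ x t, Monotone fun s => v θ (x, s, t)

theorem SemicontinuousMonotone.iSup {ι : Type*} {v : ι → Θ → ExtState E → ℝ≥0∞}
    (hv : ∀ i, SemicontinuousMonotone (v i)) :
    SemicontinuousMonotone fun θ y => ⨆ i, v i θ y where
  lsc := lowerSemicontinuous_iSup fun i => (hv i).lsc
  mono θ x t _ _ h := iSup_mono fun i => (hv i).mono θ x t h

theorem SemicontinuousMonotone.apply {v : Θ → ExtState E → ℝ≥0∞}
    (hv : SemicontinuousMonotone v) (θ : Θ) : LowerSemicontinuous (v θ) :=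
  hv.lsc.comp (Continuous.prodMk_right θ)

theorem SemicontinuousMonotone.measurable [MeasurableSpace E] [BorelSpace E]
    {v : Θ → ExtState E → ℝ≥0∞} (hv : SemicontinuousMonotone v) (θ : Θ) : Measurable (v θ) :=
  (hv.apply θ).measurable

end SemicontinuousMonotone

section Bellman

variable {E A 𝒵 Θ : Type*} [MeasurableSpace E] [MeasurableSpace A] [MeasurableSpace 𝒵]

/-- The extended transition for an admissible state-action pair `p`. -/
def Stage.move (S : Stage E A 𝒵) (β : {t : ℝ≥0 // 0 < t}) (y : ExtState E) (p : S.D) (z : 𝒵) :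
    ExtState E :=
  (S.T (p, z), y.2.1 + y.2.2.1 * S.c (p, S.T (p, z)), ⟨β.1 * y.2.2.1, mul_pos β.2 y.2.2.2⟩)

/-- The expected value of `v` after one step under the action `a`, and `⊤` if `a` is not
admissible. -/
def actionValue (S : Stage E A 𝒵) (β : {t : ℝ≥0 // 0 < t}) (μ : Measure 𝒵)
    (v : ExtState E → ℝ≥0∞) (y : ExtState E) (a : A) : ℝ≥0∞ :=
  ⨅ h : (y.1, a) ∈ S.D, ∫⁻ z, v (S.move β y ⟨(y.1, a), h⟩ z) ∂μ

/-- The Bellman operator. -/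
def bellman (S : Stage E A 𝒵) (β : {t : ℝ≥0 // 0 < t}) (μ : Measure 𝒵)
    (v : ExtState E → ℝ≥0∞) (y : ExtState E) : ℝ≥0∞ :=
  ⨅ a, actionValue S β μ v y a

theorem actionValue_mono (S : Stage E A 𝒵) (β : {t : ℝ≥0 // 0 < t}) (μ : Measure 𝒵)
    {v w : ExtState E → ℝ≥0∞} (h : v ≤ w) (y : ExtState E) (a : A) :
    actionValue S β μ v y a ≤ actionValue S β μ w y a :=
  iInf_mono fun _ => lintegral_mono fun _ => h _

theorem bellman_mono (S : Stage E A 𝒵) (β : {t : ℝ≥0 // 0 < t}) (μ : Measure 𝒵)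
    {v w : ExtState E → ℝ≥0∞} (h : v ≤ w) : bellman S β μ v ≤ bellman S β μ w :=
  fun y => iInf_mono fun a => actionValue_mono S β μ h y a

theorem actionValue_rule (S : Stage E A 𝒵) (β : {t : ℝ≥0 // 0 < t}) (μ : Measure 𝒵)
    (v : ExtState E → ℝ≥0∞) (d : MarkovRule S) (y : ExtState E) :
    actionValue S β μ v y (d.1 y) = ∫⁻ z, v (S.step β d y z) ∂μ :=
  iInf_pos (d.2.2 y)

theorem bellman_le_step (S : Stage E A 𝒵) (β : {t : ℝ≥0 // 0 < t}) (μ : Measure 𝒵)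
    (v : ExtState E → ℝ≥0∞) (d : MarkovRule S) (y : ExtState E) :
    bellman S β μ v y ≤ ∫⁻ z, v (S.step β d y z) ∂μ :=
  (iInf_le _ (d.1 y)).trans (actionValue_rule S β μ v d y).le

theorem Stage.measurable_move (S : Stage E A 𝒵) (hc : Measurable S.c)
    (β : {t : ℝ≥0 // 0 < t}) :
    Measurable fun q : (ExtState E × S.D) × 𝒵 => S.move β q.1.1 q.1.2 q.2 := by
  have hT : Measurable fun q : (ExtState E × S.D) × 𝒵 => S.T (q.1.2, q.2) :=
    S.measurable_T.comp (by fun_prop)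
  refine hT.prodMk (Measurable.prodMk ?_ ?_)
  · have : Measurable fun q : (ExtState E × S.D) × 𝒵 => S.c (q.1.2, S.T (q.1.2, q.2)) :=
      hc.comp (Measurable.prodMk (by fun_prop) hT)
    fun_prop
  · exact Measurable.subtype_mk (by fun_prop)

theorem Stage.measurable_step (S : Stage E A 𝒵) (hc : Measurable S.c)
    (β : {t : ℝ≥0 // 0 < t}) (d : MarkovRule S) :
    Measurable fun q : ExtState E × 𝒵 => S.step β d q.1 q.2 := by
  have hd : Measurable fun y : ExtState E => d.pair y :=
    Measurable.subtype_mk (measurable_fst.prodMk d.2.1)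
  exact (S.measurable_move hc β).comp
    ((measurable_fst.prodMk (hd.comp measurable_fst)).prodMk measurable_snd)

theorem Stage.measurable_move_right (S : Stage E A 𝒵) (hc : Measurable S.c)
    (β : {t : ℝ≥0 // 0 < t}) (y : ExtState E) (p : S.D) : Measurable (S.move β y p) :=
  (S.measurable_move hc β).comp (f := fun z => ((y, p), z)) measurable_prodMk_left

theorem Stage.section_nonempty (S : Stage E A 𝒵) (x : E) : {a : A | (x, a) ∈ S.D}.Nonempty :=
  let ⟨f, _, hf⟩ := S.exists_selector
  ⟨f x, hf x⟩

variable [TopologicalSpace E] [TopologicalSpace A] [TopologicalSpace Θ]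

/-- For a fixed disturbance only the accumulated cost fails to move continuously, and `v` is
increasing in that coordinate. -/
theorem SemicontinuousMonotone.move {S : Stage E A 𝒵} (hS : S.Regular)
    (β : {t : ℝ≥0 // 0 < t}) {v : Θ → ExtState E → ℝ≥0∞} (hv : SemicontinuousMonotone v) (z : 𝒵) :
    LowerSemicontinuous fun q : (Θ × ExtState E) × S.D =>
      v q.1.1 (S.move β q.1.2 q.2 z) := by
  have hT : Continuous fun q : (Θ × ExtState E) × S.D => S.T (q.2, z) :=
    (hS.continuous_T z).comp continuous_snd
  refine lowerSemicontinuous_add_mul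
    (F := fun p : ((Θ × ExtState E) × S.D) × ℝ≥0 =>
      v p.1.1.1 (S.T (p.1.2, z), p.2, ⟨β.1 * p.1.1.2.2.2.1, mul_pos β.2 p.1.1.2.2.2.2⟩))
    (s := fun q => q.1.2.2.1) (t := fun q => q.1.2.2.2.1) ?_ (fun _ _ _ h => hv.mono _ _ _ h)
    (by fun_prop) (by fun_prop) (hS.lowerSemicontinuous_c.comp (continuous_snd.prodMk hT))
  exact hv.lsc.comp (Continuous.prodMk (by fun_prop) ((hT.comp continuous_fst).prodMk
    (continuous_snd.prodMk (Continuous.subtype_mk (by fun_prop) _))))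

section

variable [TopologicalSpace.MetrizableSpace A]

theorem Stage.Regular.seqProper {S : Stage E A 𝒵} (hS : S.Regular) : SeqProper S.D := by
  intro x xs as hxs has
  obtain ⟨a, ha, hcl⟩ := hS.upperSemicontinuous x xs as hxs has
  obtain ⟨ψ, hψ, hlim⟩ := hcl.tendsto_subseq
  exact ⟨a, ψ, hψ, ha, hlim⟩

end

variable [SecondCountableTopology E] [BorelSpace E] [SecondCountableTopology A] [BorelSpace A]

theorem Stage.Regular.measurable_c {S : Stage E A 𝒵} (hS : S.Regular) : Measurable S.c :=
  hS.lowerSemicontinuous_c.measurable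

variable [TopologicalSpace.MetrizableSpace E] [TopologicalSpace.MetrizableSpace A]
  [FirstCountableTopology Θ]

/-- Fatou over the disturbance gives the claim on the admissible pairs; these form a closed set, so
the value `⊤` outside does no harm. -/
theorem SemicontinuousMonotone.actionValue {S : Stage E A 𝒵} (hS : S.Regular)
    (β : {t : ℝ≥0 // 0 < t}) (μ : Measure 𝒵) {v : Θ → ExtState E → ℝ≥0∞}
    (hv : SemicontinuousMonotone v) :
    LowerSemicontinuous fun q : (Θ × ExtState E) × A =>
      actionValue S β μ (v q.1.1) q.1.2 q.2 := by
  have hcl : IsClosed {q : (Θ × ExtState E) × A | (q.1.2.1, q.2) ∈ S.D} :=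
    hS.seqProper.isClosed.preimage (by fun_prop)
  refine lowerSemicontinuous_iInf_mem hcl
    (f := fun q => ∫⁻ z, v q.1.1.1 (S.move β q.1.1.2 ⟨(q.1.1.2.1, q.1.2), q.2⟩ z) ∂μ) ?_
  refine lowerSemicontinuous_lintegral μ (fun z => ?_) fun q => ?_
  · have hcont : Continuous fun q : {q : (Θ × ExtState E) × A | (q.1.2.1, q.2) ∈ S.D} =>
        (q.1.1, (⟨(q.1.1.2.1, q.1.2), q.2⟩ : S.D)) :=
      Continuous.prodMk (by fun_prop) (Continuous.subtype_mk (by fun_prop) _)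
    exact (hv.move hS β z).comp hcont
  · exact (hv.measurable _).comp (S.measurable_move_right hS.measurable_c β _ _)

theorem SemicontinuousMonotone.actionValue_apply {S : Stage E A 𝒵} (hS : S.Regular)
    (β : {t : ℝ≥0 // 0 < t}) (μ : Measure 𝒵) {v : Θ → ExtState E → ℝ≥0∞}
    (hv : SemicontinuousMonotone v) (θ : Θ) (y : ExtState E) :
    LowerSemicontinuous (SpectralMDP.actionValue S β μ (v θ) y) :=
  (hv.actionValue hS β μ).comp (Continuous.prodMk_right (θ, y))

theorem SemicontinuousMonotone.exists_bellman_eq {S : Stage E A 𝒵} (hS : S.Regular)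
    (β : {t : ℝ≥0 // 0 < t}) (μ : Measure 𝒵) {v : Θ → ExtState E → ℝ≥0∞}
    (hv : SemicontinuousMonotone v) (θ : Θ) (y : ExtState E) :
    ∃ a, (y.1, a) ∈ S.D ∧ SpectralMDP.actionValue S β μ (v θ) y a = bellman S β μ (v θ) y := by
  obtain ⟨a, ha, hmin⟩ := ((hv.actionValue_apply hS β μ θ y).lowerSemicontinuousOn
    {a : A | (y.1, a) ∈ S.D}).exists_isMinOn (S.section_nonempty y.1) (hS.isCompact_section y.1)
  refine ⟨a, ha, le_antisymm (le_iInf fun b => ?_) (iInf_le _ a)⟩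
  by_cases hb : (y.1, b) ∈ S.D
  · exact hmin hb
  · rw [SpectralMDP.actionValue.eq_1 S β μ (v θ) y b, iInf_neg hb]
    exact le_top

/-- Since the infimum is attained, a sublevel set of the Bellman image is the projection of a
sublevel set of the action value, which is closed by properness. -/
theorem SemicontinuousMonotone.bellman {S : Stage E A 𝒵} (hS : S.Regular)
    (β : {t : ℝ≥0 // 0 < t}) (μ : Measure 𝒵) {v : Θ → ExtState E → ℝ≥0∞}
    (hv : SemicontinuousMonotone v) :
    SemicontinuousMonotone fun θ => bellman S β μ (v θ) where
  lsc := by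
    rw [lowerSemicontinuous_iff_isClosed_preimage]
    intro r
    have hp : SeqProper {q : (Θ × ExtState E) × A | (q.1.2.1, q.2) ∈ S.D} :=
      hS.seqProper.preimage (p := fun q : Θ × ExtState E => q.2.1) (by fun_prop)
    convert hp.isClosed_image ((hv.actionValue hS β μ).isClosed_preimage r) using 1
    ext q
    constructor
    · intro hq
      obtain ⟨a, ha, h⟩ := hv.exists_bellman_eq hS β μ q.1 q.2
      exact ⟨a, ha, h.le.trans hq⟩
    · rintro ⟨a, -, h⟩
      exact (iInf_le (fun a => SpectralMDP.actionValue S β μ (v q.1) q.2 a) a).trans h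
  mono θ x t s s' hs := by
    refine iInf_mono fun a => iInf_mono fun h => lintegral_mono fun z => hv.mono _ _ _ ?_
    exact add_le_add_left hs _

/-- There is a measurable decision rule that attains the infimum in the Bellman operator. -/
theorem SemicontinuousMonotone.exists_rule {S : Stage E A 𝒵} (hS : S.Regular)
    (β : {t : ℝ≥0 // 0 < t}) (μ : Measure 𝒵) {v : Θ → ExtState E → ℝ≥0∞}
    (hv : SemicontinuousMonotone v) (θ : Θ) :
    ∃ d : MarkovRule S, ∀ y, ∫⁻ z, v θ (S.step β d y z) ∂μ = SpectralMDP.bellman S β μ (v θ) y := by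
  have hp : SeqProper {q : ExtState E × A | (q.1.1, q.2) ∈ S.D} :=
    hS.seqProper.preimage (p := fun q : ExtState E => q.1) (by fun_prop)
  have hH : LowerSemicontinuous fun q : ExtState E × A =>
      SpectralMDP.actionValue S β μ (v θ) q.1 q.2 :=
    (hv.actionValue hS β μ).comp (g := fun q : ExtState E × A => ((θ, q.1), q.2)) (by fun_prop)
  have hK : CompactMeasurable fun y : ExtState E => {a : A | (y.1, a) ∈ S.D} :=
    { nonempty := fun y => S.section_nonempty y.1
      isCompact := fun y => hS.isCompact_section y.1
      measurableSet_hit := fun F hF =>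
        (hp.isClosed_image (hF.preimage continuous_snd)).measurableSet }
  -- The hitting sets required here are even closed, again as projections along a proper relation.
  obtain ⟨f, hf, hmem⟩ := (hK.argminOn (hv.actionValue_apply hS β μ θ) fun F hF r =>
    (hp.isClosed_image
      ((hF.preimage continuous_snd).inter (hH.isClosed_preimage r))).measurableSet).exists_selector
  refine ⟨⟨f, hf, fun y => (hmem y).1⟩, fun y => ?_⟩
  obtain ⟨a, ha, h⟩ := hv.exists_bellman_eq hS β μ θ y
  exact (actionValue_rule S β μ (v θ) _ y).symm.trans
    (le_antisymm (((hmem y).2 a ha).trans h.le) (iInf_le _ (f y)))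

/-- The Bellman operator commutes with increasing limits. -/
theorem bellman_iSup_le {S : Stage E A 𝒵} (hS : S.Regular)
    (β : {t : ℝ≥0 // 0 < t}) (μ : Measure 𝒵) {v : ℕ → Θ → ExtState E → ℝ≥0∞}
    (hv : ∀ n, SemicontinuousMonotone (v n)) (hmono : Monotone v) (θ : Θ) (y : ExtState E) :
    bellman S β μ (fun y => ⨆ n, v n θ y) y ≤ ⨆ n, bellman S β μ (v n θ) y := by
  let r := ⨆ n, bellman S β μ (v n θ) y
  -- The actions whose `n`-th value is at most `r` form decreasing nonempty compact sets. A common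
  -- action works for all `n`, and monotone convergence evaluates it at the limit.
  let K : ℕ → Set A := fun n => {a | (y.1, a) ∈ S.D} ∩ actionValue S β μ (v n θ) y ⁻¹' Set.Iic r
  have hcl : IsClosed {a : A | (y.1, a) ∈ S.D} := (hS.isCompact_section y.1).isClosed
  obtain ⟨a, ha⟩ := IsCompact.nonempty_iInter_of_sequence_nonempty_isCompact_isClosed K
    (fun n => Set.inter_subset_inter_right _ fun a ha =>
      (actionValue_mono S β μ (hmono n.le_succ θ) y a).trans ha)
    (fun n => by
      obtain ⟨a, ha, h⟩ := (hv n).exists_bellman_eq hS β μ θ y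
      exact ⟨a, ha, h.le.trans (le_iSup (fun n => bellman S β μ (v n θ) y) n)⟩)
    ((hS.isCompact_section y.1).inter_right
      (((hv 0).actionValue_apply hS β μ θ y).isClosed_preimage r))
    (fun n => hcl.inter (((hv n).actionValue_apply hS β μ θ y).isClosed_preimage r))
  have ha := Set.mem_iInter.mp ha
  refine (iInf_le _ a).trans ?_
  have haD : (y.1, a) ∈ S.D := (ha 0).1
  rw [actionValue, iInf_pos haD, lintegral_iSup]
  · refine iSup_le fun n => ?_
    have := (ha n).2
    rwa [Set.mem_preimage, actionValue, iInf_pos haD] at this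
  · exact fun n => ((hv n).measurable θ).comp
      (S.measurable_move_right hS.measurable_c β _ _)
  · exact fun m n h z => hmono h θ _

end Bellman

end SpectralMDP

end

noncomputable section

namespace SpectralMDP

/-! ### Expected values along trajectories -/

section Trajectory

variable {E A 𝒵 Ω : Type*} [MeasurableSpace E] [MeasurableSpace A] [MeasurableSpace 𝒵]
  {M : ℕ → Stage E A 𝒵} {β : {t : ℝ≥0 // 0 < t}} {Z : ℕ → Ω → 𝒵}

theorem traj_cost (π : MarkovPolicy M) (y : ExtState E) (n : ℕ) (ω : Ω) :
    (traj M β Z π y n ω).2.1 = y.2.1 + y.2.2.1 *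
        ∑ k ∈ Finset.range n, β.1 ^ k * stageCost M β Z π y k ω ∧
      (traj M β Z π y n ω).2.2.1 = β.1 ^ n * y.2.2.1 := by
  induction n with
  | zero => simp [traj]
  | succ n ih =>
    constructor
    · have : (traj M β Z π y (n + 1) ω).2.1 = (traj M β Z π y n ω).2.1 +
          (traj M β Z π y n ω).2.2.1 * stageCost M β Z π y n ω := rfl
      rw [this, ih.1, ih.2, Finset.sum_range_succ]
      ring
    · have : (traj M β Z π y (n + 1) ω).2.2.1 = β.1 * (traj M β Z π y n ω).2.2.1 := rfl
      rw [this, ih.2]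
      ring

/-- The state at time `n` uses only the disturbances before `n`; this makes it independent of `Z n`.
-/
theorem measurable_traj_past (π : MarkovPolicy M) (y : ExtState E) {n : ℕ}
    (hc : ∀ k < n, Measurable (M k).c) :
    Measurable[⨆ k ∈ Set.Iio n, MeasurableSpace.comap (Z k) inferInstance]
      (traj M β Z π y n) := by
  induction n with
  | zero => exact measurable_const
  | succ n ih =>
    have h1 : Measurable[⨆ k ∈ Set.Iio (n + 1), MeasurableSpace.comap (Z k) inferInstance]
        (traj M β Z π y n) :=
      (ih fun k hk => hc k (hk.trans n.lt_succ_self)).mono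
        (biSup_mono fun k hk => lt_trans hk n.lt_succ_self) le_rfl
    have h2 : Measurable[⨆ k ∈ Set.Iio (n + 1), MeasurableSpace.comap (Z k) inferInstance]
        (Z n) :=
      (comap_measurable (Z n)).mono
        (le_iSup₂ (f := fun k (_ : k ∈ Set.Iio (n + 1)) =>
          MeasurableSpace.comap (Z k) inferInstance) n n.lt_succ_self) le_rfl
    exact ((M n).measurable_step (hc n n.lt_succ_self) β (π n)).comp (h1.prodMk h2)

variable [MeasurableSpace Ω] {P : Measure Ω}

theorem measurable_traj (hZ : ∀ n, Measurable (Z n)) (π : MarkovPolicy M) (y : ExtState E) {n : ℕ}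
    (hc : ∀ k < n, Measurable (M k).c) : Measurable (traj M β Z π y n) :=
  (measurable_traj_past π y hc).mono (iSup₂_le fun k _ => (hZ k).comap_le) le_rfl

theorem indepFun_traj (hZ : ∀ n, Measurable (Z n)) (hindep : iIndepFun Z P) (π : MarkovPolicy M)
    (y : ExtState E) {n : ℕ} (hc : ∀ k < n, Measurable (M k).c) :
    IndepFun (traj M β Z π y n) (Z n) P := by
  have h := indep_iSup_of_disjoint (fun k => (hZ k).comap_le) hindep.iIndep
    (S := Set.Iio n) (T := {n}) (by simp)
  rw [IndepFun_iff_Indep]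
  refine indep_of_indep_of_le_left (indep_of_indep_of_le_right h ?_)
    (measurable_traj_past π y hc).comap_le
  simp

variable [IsProbabilityMeasure P]

/-- The Markov property: independence turns the joint law of state and disturbance into a product,
to which Tonelli applies. -/
theorem lintegral_traj_succ (hZ : ∀ n, Measurable (Z n)) (hindep : iIndepFun Z P)
    (π : MarkovPolicy M) (y : ExtState E) {n : ℕ} (hc : ∀ k ≤ n, Measurable (M k).c)
    {v : ExtState E → ℝ≥0∞} (hv : Measurable v) :
    ∫⁻ ω, v (traj M β Z π y (n + 1) ω) ∂P =
      ∫⁻ ω, ∫⁻ z, v ((M n).step β (π n) (traj M β Z π y n ω) z) ∂(P.map (Z n)) ∂P := by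
  have hF : Measurable fun q : ExtState E × 𝒵 => v ((M n).step β (π n) q.1 q.2) :=
    hv.comp ((M n).measurable_step (hc n le_rfl) β (π n))
  have ht := measurable_traj (β := β) hZ π y fun k (hk : k < n) => hc k hk.le
  have : IsProbabilityMeasure (P.map (Z n)) := Measure.isProbabilityMeasure_map (hZ n).aemeasurable
  have : IsProbabilityMeasure (P.map (traj M β Z π y n)) :=
    Measure.isProbabilityMeasure_map ht.aemeasurable
  calc ∫⁻ ω, v (traj M β Z π y (n + 1) ω) ∂P
      = ∫⁻ q, v ((M n).step β (π n) q.1 q.2)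
          ∂(P.map fun ω => (traj M β Z π y n ω, Z n ω)) :=
        (lintegral_map hF (ht.prodMk (hZ n))).symm
    _ = _ := by
        rw [(indepFun_iff_map_prod_eq_prod_map_map ht.aemeasurable (hZ n).aemeasurable).mp
          (indepFun_traj hZ hindep π y fun k hk => hc k hk.le), lintegral_prod _ hF.aemeasurable,
          lintegral_map hF.lintegral_prod_right' ht]

/-- For a subsolution of the Bellman equation the expected value cannot decrease in time, whatever
the policy. -/
theorem le_lintegral_traj (hZ : ∀ n, Measurable (Z n)) (hindep : iIndepFun Z P)
    (π : MarkovPolicy M) (y : ExtState E) {N : ℕ} (hc : ∀ k < N, Measurable (M k).c)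
    {v : ℕ → ExtState E → ℝ≥0∞} (hv : ∀ n ≤ N, Measurable (v n))
    (h : ∀ n < N, v n ≤ bellman (M n) β (P.map (Z n)) (v (n + 1))) :
    v 0 y ≤ ∫⁻ ω, v N (traj M β Z π y N ω) ∂P := by
  induction N with
  | zero => simp [traj]
  | succ N ih =>
    refine (ih (fun k hk => hc k (by lia)) (fun n hn => hv n (by lia))
      fun n hn => h n (by lia)).trans ?_
    rw [lintegral_traj_succ hZ hindep π y (fun k hk => hc k (by lia)) (hv _ le_rfl)]
    exact lintegral_mono fun ω => (h N (by lia) _).trans (bellman_le_step _ _ _ _ _ _)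

/-- The reverse bound, for a policy whose rules realize a supersolution. -/
theorem lintegral_traj_le (hZ : ∀ n, Measurable (Z n)) (hindep : iIndepFun Z P)
    (π : MarkovPolicy M) (y : ExtState E) {N : ℕ} (hc : ∀ k < N, Measurable (M k).c)
    {v : ℕ → ExtState E → ℝ≥0∞} (hv : ∀ n ≤ N, Measurable (v n))
    (h : ∀ n < N, ∀ y, ∫⁻ z, v (n + 1) ((M n).step β (π n) y z) ∂(P.map (Z n)) ≤ v n y) :
    ∫⁻ ω, v N (traj M β Z π y N ω) ∂P ≤ v 0 y := by
  induction N with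
  | zero => simp [traj]
  | succ N ih =>
    rw [lintegral_traj_succ hZ hindep π y (fun k hk => hc k (by lia)) (hv _ le_rfl)]
    exact (lintegral_mono fun ω => h N (by lia) _).trans
      (ih (fun k hk => hc k (by lia)) (fun n hn => hv n (by lia)) fun n hn => h n (by lia))

end Trajectory

/-! ### The value functions as solutions of the Bellman equation -/

section Terminal

variable {E Θ : Type*}

/-- The value at the horizon, if the total cost is evaluated by `g` and the terminal cost is
`cN`. -/
def terminalValue (cN : E → ℝ≥0) (g : ℝ → ℝ) (y : ExtState E) : ℝ≥0∞ :=
  ENNReal.ofReal (g ((y.2.1 + y.2.2.1 * cN y.1 : ℝ≥0) : ℝ))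

theorem SemicontinuousMonotone.terminalValue [TopologicalSpace E] [TopologicalSpace Θ] {cN : E → ℝ≥0} (hcN : LowerSemicontinuous cN)
    {G : Θ → ℝ → ℝ} (hG : Continuous fun q : Θ × ℝ => G q.1 q.2) (hmono : ∀ θ, Monotone (G θ)) :
    SemicontinuousMonotone fun θ => terminalValue cN (G θ) where
  lsc := by
    refine lowerSemicontinuous_add_mul
      (F := fun p : (Θ × ExtState E) × ℝ≥0 => ENNReal.ofReal (G p.1.1 p.2))
      (s := fun q => q.2.2.1) (t := fun q => q.2.2.2.1) (c := fun q => cN q.2.1)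
      (Continuous.lowerSemicontinuous ?_) (fun x r r' h => ?_) (by fun_prop) (by fun_prop)
      (hcN.comp (by fun_prop))
    · exact ENNReal.continuous_ofReal.comp (hG.comp
        (f := fun p : (Θ × ExtState E) × ℝ≥0 => (p.1.1, (p.2 : ℝ))) (by fun_prop))
    · exact ENNReal.ofReal_le_ofReal (hmono _ (NNReal.coe_le_coe.mpr h))
  mono θ x t s s' h := ENNReal.ofReal_le_ofReal (hmono _ (NNReal.coe_le_coe.mpr
    (add_le_add_left h _)))

end Terminal

section Value

variable {E A 𝒵 Ω Θ : Type*} [MeasurableSpace E] [MeasurableSpace A] [MeasurableSpace 𝒵]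

/-- Backward induction: the value function with `m` stages to go, for a model with horizon `N` and
terminal value `w`. -/
def backward (M : ℕ → Stage E A 𝒵) (β : {t : ℝ≥0 // 0 < t}) (μ : ℕ → Measure 𝒵) (N : ℕ)
    (w : ExtState E → ℝ≥0∞) : ℕ → ExtState E → ℝ≥0∞
  | 0 => w
  | m + 1 => bellman (M (N - (m + 1))) β (μ (N - (m + 1))) (backward M β μ N w m)

theorem extend_iSup {g : ℝ → ℝ} (hg : Continuous g) (hmono : Monotone g) {s : ℕ → ℝ≥0}
    (hs : Monotone s) :
    extend g (⨆ n, (s n : ℝ≥0∞)) = ⨆ n, ENNReal.ofReal (g (s n)) := by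
  apply le_antisymm
  · refine iSup₂_le fun r hr => ?_
    rcases hr.lt_or_eq with hlt | heq
    · obtain ⟨n, hn⟩ := lt_iSup_iff.mp hlt
      exact le_iSup_of_le n (ENNReal.ofReal_le_ofReal
        (hmono (NNReal.coe_le_coe.mpr (ENNReal.coe_le_coe.mp hn.le))))
    -- The supremum need not be reached by any `s n`; continuity of `g` covers this endpoint.
    · have hlim : Tendsto s atTop (𝓝 r) := by
        rw [← ENNReal.tendsto_coe, heq]
        exact tendsto_atTop_iSup fun m n h => ENNReal.coe_le_coe.mpr (hs h)
      have hlim' : Tendsto (fun n => ENNReal.ofReal (g (s n))) atTop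
          (𝓝 (ENNReal.ofReal (g r))) :=
        ENNReal.tendsto_ofReal ((hg.tendsto _).comp (NNReal.tendsto_coe.mpr hlim))
      exact le_of_tendsto' hlim' fun n => le_iSup (fun n => ENNReal.ofReal (g (s n))) n
  · exact iSup_le fun n => le_iSup₂ (f := fun (r : ℝ≥0) (_ : (r : ℝ≥0∞) ≤ ⨆ n, (s n : ℝ≥0∞)) =>
      ENNReal.ofReal (g r)) (s n) (le_iSup (fun n => (s n : ℝ≥0∞)) n)

theorem totalCost_eq_iSup {M : ℕ → Stage E A 𝒵} {β : {t : ℝ≥0 // 0 < t}} {Z : ℕ → Ω → 𝒵}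
    (π : MarkovPolicy M) (y : ExtState E) (ω : Ω) :
    (y.2.1 : ℝ≥0∞) + (y.2.2.1 : ℝ≥0∞) *
        ∑' k : ℕ, ((β.1 ^ k * stageCost M β Z π y k ω : ℝ≥0) : ℝ≥0∞) =
      ⨆ n, ((traj M β Z π y n ω).2.1 : ℝ≥0∞) := by
  rw [ENNReal.tsum_eq_iSup_nat, ENNReal.mul_iSup, ENNReal.add_iSup]
  refine iSup_congr fun n => ?_
  rw [(traj_cost π y n ω).1]
  push_cast
  rfl

theorem monotone_traj_cost {M : ℕ → Stage E A 𝒵} {β : {t : ℝ≥0 // 0 < t}} {Z : ℕ → Ω → 𝒵}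
    (π : MarkovPolicy M) (y : ExtState E) (ω : Ω) :
    Monotone fun n => (traj M β Z π y n ω).2.1 :=
  monotone_nat_of_le_succ fun _ => le_self_add

variable [TopologicalSpace E] [TopologicalSpace Θ]

variable [TopologicalSpace A]
  [TopologicalSpace.MetrizableSpace E] [SecondCountableTopology E] [BorelSpace E]
  [TopologicalSpace.MetrizableSpace A] [SecondCountableTopology A] [BorelSpace A]
  [FirstCountableTopology Θ]

theorem SemicontinuousMonotone.backward {M : ℕ → Stage E A 𝒵} {N : ℕ}
    (hM : ∀ n < N, (M n).Regular) (β : {t : ℝ≥0 // 0 < t}) (μ : ℕ → Measure 𝒵)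
    {w : Θ → ExtState E → ℝ≥0∞} (hw : SemicontinuousMonotone w) {m : ℕ} (hm : m ≤ N) :
    SemicontinuousMonotone fun θ => backward M β μ N (w θ) m := by
  induction m with
  | zero => exact hw
  | succ m ih => exact (ih (by lia)).bellman (hM _ (by lia)) β _

theorem SemicontinuousMonotone.iterate_bellman {S : Stage E A 𝒵} (hS : S.Regular)
    (β : {t : ℝ≥0 // 0 < t}) (μ : Measure 𝒵) {w : Θ → ExtState E → ℝ≥0∞}
    (hw : SemicontinuousMonotone w) (m : ℕ) :
    SemicontinuousMonotone fun θ => (SpectralMDP.bellman S β μ)^[m] (w θ) := by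
  induction m with
  | zero => exact hw
  | succ m ih =>
    simp only [Function.iterate_succ_apply']
    exact ih.bellman hS β μ

variable [MeasurableSpace Ω] {P : Measure Ω} [IsProbabilityMeasure P] {β : {t : ℝ≥0 // 0 < t}}
  {Z : ℕ → Ω → 𝒵}

theorem valueFin_eq_backward (hZ : ∀ n, Measurable (Z n)) (hindep : iIndepFun Z P)
    {M : ℕ → Stage E A 𝒵} {N : ℕ} (hM : ∀ n < N, (M n).Regular) {cN : E → ℝ≥0}
    (hcN : LowerSemicontinuous cN) {G : Θ → ℝ → ℝ} (hG : Continuous fun q : Θ × ℝ => G q.1 q.2)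
    (hmono : ∀ θ, Monotone (G θ)) (θ : Θ) (y : ExtState E) :
    valueFin P M cN β Z N (G θ) y =
      backward M β (fun n => P.map (Z n)) N (terminalValue cN (G θ)) N y := by
  have hsm := SemicontinuousMonotone.terminalValue hcN hG hmono
  -- Backward induction counts stages to go; at time `n` there are `N - n`.
  have hv := fun n => hsm.backward hM β (fun n => P.map (Z n)) (m := N - n) (Nat.sub_le _ _)
  have hstep : ∀ n < N, backward M β (fun n => P.map (Z n)) N (terminalValue cN (G θ)) (N - n) =
      bellman (M n) β (P.map (Z n))
        (backward M β (fun n => P.map (Z n)) N (terminalValue cN (G θ)) (N - (n + 1))) := by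
    intro n hn
    obtain ⟨m, rfl⟩ : ∃ m, N = n + (m + 1) := ⟨N - n - 1, by lia⟩
    have h1 : n + (m + 1) - n = m + 1 := by lia
    have h2 : n + (m + 1) - (n + 1) = m := by lia
    have h3 : n + (m + 1) - (m + 1) = n := by lia
    rw [h1, h2, SpectralMDP.backward, h3]
  have hcost : ∀ π : MarkovPolicy M, ∫⁻ ω, ENNReal.ofReal (G θ ((y.2.1 + y.2.2.1 *
        (∑ k ∈ Finset.range N, β.1 ^ k * stageCost M β Z π y k ω
          + β.1 ^ N * cN (traj M β Z π y N ω).1) : ℝ≥0) : ℝ)) ∂P =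
      ∫⁻ ω, backward M β (fun n => P.map (Z n)) N (terminalValue cN (G θ)) (N - N)
        (traj M β Z π y N ω) ∂P := by
    intro π
    refine lintegral_congr fun ω => ?_
    rw [Nat.sub_self, SpectralMDP.backward, terminalValue, (traj_cost π y N ω).1,
      (traj_cost π y N ω).2]
    congr 3
    ring
  have hc : ∀ k < N, Measurable (M k).c := fun k hk => (hM k hk).measurable_c
  apply le_antisymm
  · have hrule : ∀ n, ∃ d : MarkovRule (M n), n < N → ∀ y, ∫⁻ z,
        backward M β (fun n => P.map (Z n)) N (terminalValue cN (G θ)) (N - (n + 1))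
          ((M n).step β d y z) ∂(P.map (Z n)) ≤
        backward M β (fun n => P.map (Z n)) N (terminalValue cN (G θ)) (N - n) y := by
      intro n
      by_cases hn : n < N
      · obtain ⟨d, hd⟩ := (hv (n + 1)).exists_rule (hM n hn) β (P.map (Z n)) θ
        exact ⟨d, fun _ y => by rw [hd, hstep n hn]⟩
      -- Rules from time `N` on never enter the cost and need not be optimal; any measurable
      -- selector completes the policy.
      · obtain ⟨f, hf, hfD⟩ := (M n).exists_selector
        exact ⟨⟨fun y => f y.1, hf.comp measurable_fst, fun y => hfD y.1⟩, fun h => absurd h hn⟩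
    choose π hπ using hrule
    refine (iInf_le _ π).trans ((hcost π).le.trans ?_)
    exact lintegral_traj_le hZ hindep π y hc
      (v := fun n => backward M β (fun n => P.map (Z n)) N (terminalValue cN (G θ)) (N - n))
      (fun n _ => (hv n).measurable θ) hπ
  · refine le_iInf fun π => ?_
    rw [hcost]
    exact le_lintegral_traj hZ hindep π y hc
      (v := fun n => backward M β (fun n => P.map (Z n)) N (terminalValue cN (G θ)) (N - n))
      (fun n _ => (hv n).measurable θ) fun n hn => (hstep n hn).le

/-- Every policy's cost dominates its `N`-stage truncations, hence every iterate. Conversely the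
supremum of the iterates is a supersolution, and the rule attaining its Bellman infimum, used at all
times, keeps every truncated cost below it. -/
theorem valueInf_eq_iSup (hZ : ∀ n, Measurable (Z n)) (hindep : iIndepFun Z P)
    (hid : ∀ n, IdentDistrib (Z n) (Z 0) P P) {S : Stage E A 𝒵} (hS : S.Regular) {G : Θ → ℝ → ℝ}
    (hG : Continuous fun q : Θ × ℝ => G q.1 q.2)
    (hmono : ∀ θ, Monotone (G θ)) (θ : Θ) (y : ExtState E) :
    valueInf P S β Z (G θ) y =
      ⨆ n, (bellman S β (P.map (Z 0)))^[n] (terminalValue 0 (G θ)) y := by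
  have hsm := SemicontinuousMonotone.terminalValue (E := E) (cN := 0)
    lowerSemicontinuous_const hG hmono
  have hw := hsm.iterate_bellman hS β (P.map (Z 0))
  have : IsProbabilityMeasure (P.map (Z 0)) := Measure.isProbabilityMeasure_map (hZ 0).aemeasurable
  have hmap : ∀ n, P.map (Z n) = P.map (Z 0) := fun n => (hid n).map_eq
  have hterm : ∀ θ (y : ExtState E), terminalValue 0 (G θ) y = ENNReal.ofReal (G θ y.2.1) := by
    simp [terminalValue]
  have hw_mono : Monotone fun n θ => (bellman S β (P.map (Z 0)))^[n] (terminalValue 0 (G θ)) := by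
    intro m n hmn θ
    have hB : Monotone (bellman S β (P.map (Z 0))) := fun _ _ h => bellman_mono S β _ h
    refine hB.monotone_iterate_of_le_map ?_ hmn
    refine fun y => le_iInf fun a => le_iInf fun h => ?_
    -- The iteration starts from a subsolution, because accumulated cost never decreases and the
    -- disturbance law has mass one.
    calc terminalValue 0 (G θ) y = ∫⁻ _, terminalValue 0 (G θ) y ∂(P.map (Z 0)) := by simp
      _ ≤ _ := lintegral_mono fun z => by
        rw [hterm, hterm]
        exact ENNReal.ofReal_le_ofReal (hmono θ (NNReal.coe_le_coe.mpr le_self_add))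
  have hext : ∀ (π : MarkovPolicy fun _ : ℕ => S), ∫⁻ ω, extend (G θ) ((y.2.1 : ℝ≥0∞) +
        (y.2.2.1 : ℝ≥0∞) * ∑' k : ℕ,
          ((β.1 ^ k * stageCost (fun _ : ℕ => S) β Z π y k ω : ℝ≥0) : ℝ≥0∞)) ∂P =
      ⨆ n, ∫⁻ ω, terminalValue 0 (G θ) (traj (fun _ : ℕ => S) β Z π y n ω) ∂P := by
    intro π
    have hcont : Continuous (G θ) := hG.comp (Continuous.prodMk_right θ)
    rw [← lintegral_iSup]
    · refine lintegral_congr fun ω => ?_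
      rw [totalCost_eq_iSup, extend_iSup hcont (hmono θ) (monotone_traj_cost π y ω)]
      simp only [hterm]
    · exact fun n => (hsm.measurable θ).comp (measurable_traj hZ π y fun _ _ => hS.measurable_c)
    · intro m n hmn ω
      simp only [hterm]
      exact ENNReal.ofReal_le_ofReal
        (hmono θ (NNReal.coe_le_coe.mpr (monotone_traj_cost π y ω hmn)))
  apply le_antisymm
  · obtain ⟨d, hd⟩ := (SemicontinuousMonotone.iSup hw).exists_rule hS β (P.map (Z 0)) θ
    refine (iInf_le _ fun _ => d).trans ((hext fun _ => d).le.trans ?_)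
    refine iSup_le fun N => (lintegral_mono fun ω => ?_).trans
      (lintegral_traj_le (β := β) hZ hindep (fun _ => d) y (N := N) (fun _ _ => hS.measurable_c)
        (v := fun _ y => ⨆ n, (bellman S β (P.map (Z 0)))^[n] (terminalValue 0 (G θ)) y)
        (fun _ _ => (SemicontinuousMonotone.iSup hw).measurable θ) fun n _ y => ?_)
    · exact le_iSup (fun n => (bellman S β (P.map (Z 0)))^[n] (terminalValue 0 (G θ)) _) 0
    · rw [hmap n, hd]
      refine (bellman_iSup_le hS β _ hw hw_mono θ y).trans (iSup_le fun n => ?_)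
      rw [← Function.iterate_succ_apply' (bellman S β (P.map (Z 0)))]
      exact le_iSup (fun n => (bellman S β (P.map (Z 0)))^[n] (terminalValue 0 (G θ)) y) (n + 1)
  · refine le_iInf fun π => ?_
    rw [hext]
    refine iSup_mono fun N => ?_
    have := le_lintegral_traj hZ hindep π y (β := β) (N := N) (fun _ _ => hS.measurable_c)
      (v := fun n => (bellman S β (P.map (Z 0)))^[N - n] (terminalValue 0 (G θ)))
      (fun n _ => (hw _).measurable θ) fun n hn => by
        rw [hmap n, ← Function.iterate_succ_apply' (bellman S β (P.map (Z 0)))]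
        rw [show (N - (n + 1)).succ = N - n by lia]
    simpa using this

end Value

end SpectralMDP

end

noncomputable section

namespace SpectralMDP

/-! ### The outer problem -/

/-- Tychonoff: all the constraints are closed under pointwise limits and the bounds confine `g` to a
product of compact intervals. -/
theorem isCompact_feasible (L ρ : ℝ≥0) : IsCompact (feasible L ρ) := by
  have hbox : IsCompact (Set.univ.pi fun x : ℝ => Set.Icc (0 : ℝ) (L * max x 0 + ρ)) :=
    isCompact_univ_pi fun _ => isCompact_Icc
  refine hbox.of_isClosed_subset ?_ fun g hg x _ => hg.2.2.2 x
  have hconv : IsClosed {g : ℝ → ℝ | ConvexOn ℝ Set.univ g} := by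
    simp only [ConvexOn, convex_univ, true_and, Set.ofPred_forall]
    refine isClosed_iInter fun x => isClosed_iInter fun _ => isClosed_iInter fun y =>
      isClosed_iInter fun _ => isClosed_iInter fun a => isClosed_iInter fun b =>
      isClosed_iInter fun _ => isClosed_iInter fun _ => isClosed_iInter fun _ => ?_
    exact isClosed_le (by fun_prop) (by fun_prop)
  have hbound : IsClosed {g : ℝ → ℝ | ∀ x, 0 ≤ g x ∧ g x ≤ L * max x 0 + ρ} := by
    simp only [Set.ofPred_forall, Set.ofPred_and]
    exact isClosed_iInter fun x => (isClosed_le continuous_const (continuous_apply x)).inter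
      (isClosed_le (continuous_apply x) continuous_const)
  exact isClosed_monotone.inter (hconv.inter ((isClosed_setOfPred_lipschitzWith L).inter hbound))

/-- The feasible functions with the topology of locally uniform convergence. -/
abbrev Feasible (L ρ : ℝ≥0) := {f : C(ℝ, ℝ) // ⇑f ∈ feasible L ρ}

/-- Equicontinuity upgrades pointwise to locally uniform compactness. The finer topology is used
because it makes evaluation jointly continuous and is first countable, as Fatou demands. -/
instance compactSpace_feasible (L ρ : ℝ≥0) : CompactSpace (Feasible L ρ) := by
  refine (isCompact_iff_compactSpace (s := {f : C(ℝ, ℝ) | ⇑f ∈ feasible L ρ})).mp ?_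
  refine ArzelaAscoli.isCompact_of_equicontinuous _ ?_ ?_
  · convert isCompact_feasible L ρ using 1
    ext g
    refine ⟨?_, fun hg => ⟨⟨g, hg.2.2.1.continuous⟩, hg, rfl⟩⟩
    rintro ⟨f, hf, rfl⟩
    exact hf
  · exact (LipschitzWith.uniformEquicontinuous _ L fun f => f.2.2.2.1).equicontinuous

instance firstCountableTopology_feasible (L ρ : ℝ≥0) : FirstCountableTopology (Feasible L ρ) :=
  have : FirstCountableTopology C(ℝ, ℝ) := UniformSpace.firstCountableTopology _
  IsInducing.subtypeVal.firstCountableTopology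

theorem zero_mem_feasible (L ρ : ℝ≥0) : (fun _ => 0) ∈ feasible L ρ :=
  ⟨monotone_const, convexOn_const 0 convex_univ, LipschitzWith.const' 0,
    fun x => ⟨le_rfl, by positivity⟩⟩

/-! ### The conjugate penalty -/

theorem lowerSemicontinuous_conjugate (g : ℝ → ℝ) : LowerSemicontinuous (conjugate g) :=
  lowerSemicontinuous_iSup fun s =>
    (continuous_coe_real_ereal.comp (by fun_prop)).lowerSemicontinuous

theorem neg_le_conjugate {L ρ : ℝ≥0} {g : ℝ → ℝ} (hg : g ∈ feasible L ρ) (y : ℝ) :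
    ((-ρ : ℝ) : EReal) ≤ conjugate g y := by
  -- Take `s = 0` and use `g 0 ≤ ρ`.
  refine le_trans ?_ (le_iSup (fun s : ℝ => ((s * y - g s : ℝ) : EReal)) 0)
  have := (hg.2.2.2 0).2
  simp only [max_self, mul_zero, zero_add] at this
  exact EReal.coe_le_coe_iff.mpr (by linarith)

/-- Write `c⁺ = c + c⁻` and use `c + ρ ≥ 0`. In this additive form the identity integrates without
subtraction in `[0, ∞]`. -/
theorem toENNReal_add_eq {c : EReal} {ρ : ℝ≥0} (h : ((-ρ : ℝ) : EReal) ≤ c) :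
    c.toENNReal + ρ = (c + (ρ : ℝ)).toENNReal + (-c).toENNReal := by
  induction c with
  | bot => simp at h
  | top => simp
  | coe c =>
    have h : -(ρ : ℝ) ≤ c := EReal.coe_le_coe_iff.mp h
    rw [← EReal.coe_add, ← EReal.coe_neg]
    rw [EReal.toENNReal_of_ne_top (EReal.coe_ne_top _), EReal.toENNReal_of_ne_top
      (EReal.coe_ne_top _), EReal.toENNReal_of_ne_top (EReal.coe_ne_top _), EReal.toReal_coe,
      EReal.toReal_coe, EReal.toReal_coe]
    rw [← ENNReal.ofReal_coe_nnreal (p := ρ)]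
    rcases le_total 0 c with hc | hc
    · rw [ENNReal.ofReal_of_nonpos (by linarith : -c ≤ 0), add_zero,
        ENNReal.ofReal_add hc ρ.coe_nonneg]
    · rw [ENNReal.ofReal_of_nonpos hc, zero_add,
        ← ENNReal.ofReal_add (by linarith) (by linarith)]
      congr 1
      ring

theorem coe_sub_coe_eq {p q n : ℝ≥0∞} {ρ : ℝ≥0} (hn : n ≠ ⊤) (h : p + ρ = q + n) :
    (p : EReal) - n = q - (ρ : ℝ) := by
  lift n to ℝ≥0 using hn
  rcases eq_or_ne p ⊤ with rfl | hp
  · have : q = ⊤ := by simpa using h.symm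
    subst this
    simp
  · have hq : q ≠ ⊤ := fun hq => by simp [hq, hp] at h
    lift p to ℝ≥0 using hp
    lift q to ℝ≥0 using hq
    have h : (p : ℝ) + ρ = q + n := by exact_mod_cast h
    change ((p : ℝ) : EReal) - ((n : ℝ) : EReal) = ((q : ℝ) : EReal) - ((ρ : ℝ) : EReal)
    rw [← EReal.coe_sub, ← EReal.coe_sub]
    congr 1
    linarith

theorem measurable_conjugate_comp {φ : I → ℝ≥0} (hφ : Monotone φ) (g : ℝ → ℝ) :
    Measurable fun u => conjugate g (φ u) :=
  (lowerSemicontinuous_conjugate g).measurable.comp (measurable_coe_nnreal_real.comp hφ.measurable)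

/-- The unit interval has mass one, so shifting the conjugate by `ρ` shifts the objective by the
constant `ρ` and leaves a nonnegative functional to minimize. -/
theorem outerObjective_eq {L ρ : ℝ≥0} {φ : I → ℝ≥0} (hφ : Monotone φ) (J : (ℝ → ℝ) → ℝ≥0∞)
    {g : ℝ → ℝ} (hg : g ∈ feasible L ρ) :
    outerObjective J φ g =
      ((J g + ∫⁻ u, (conjugate g (φ u) + (ρ : ℝ)).toENNReal : ℝ≥0∞) : EReal) - (ρ : ℝ) := by
  have hm := measurable_conjugate_comp hφ g
  have hle : ∫⁻ u, (-conjugate g (φ u)).toENNReal ≤ ρ := by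
    calc ∫⁻ u, (-conjugate g (φ u)).toENNReal ≤ ∫⁻ _ : I, ρ := by
          refine lintegral_mono fun u => ?_
          have := EReal.toENNReal_le_toENNReal (EReal.neg_le_neg_iff.mpr
            (neg_le_conjugate hg (φ u)))
          simpa [← EReal.coe_neg] using this
      _ = ρ := by simp
  have hmn : Measurable fun u => (-conjugate g (φ u)).toENNReal :=
    (continuous_neg.measurable.comp hm).ereal_toENNReal
  have hsum : ∫⁻ u, (conjugate g (φ u)).toENNReal + ρ =
      (∫⁻ u, (conjugate g (φ u) + (ρ : ℝ)).toENNReal) +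
        ∫⁻ u, (-conjugate g (φ u)).toENNReal := by
    rw [← lintegral_add_right _ hmn]
    exact lintegral_congr fun u => toENNReal_add_eq (neg_le_conjugate hg _)
  have hsum' : ∫⁻ u, (conjugate g (φ u)).toENNReal + ρ =
      (∫⁻ u, (conjugate g (φ u)).toENNReal) + ρ := by
    rw [lintegral_add_right _ measurable_const]
    simp
  rw [outerObjective, integral01, coe_sub_coe_eq (hle.trans_lt ENNReal.coe_lt_top).ne
    (hsum'.symm.trans hsum), EReal.coe_ennreal_add, sub_eq_add_neg, sub_eq_add_neg, add_assoc]

/-- At fixed `u` the conjugate is a supremum over `s` of functions continuous in `θ`; the shift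
makes the integrand nonnegative for Fatou. -/
theorem lowerSemicontinuous_lintegral_conjugate {φ : I → ℝ≥0} (hφ : Monotone φ) (L ρ : ℝ≥0) :
    LowerSemicontinuous fun θ : Feasible L ρ =>
      ∫⁻ u, (conjugate θ.1 (φ u) + (ρ : ℝ)).toENNReal := by
  have hadd : Continuous fun c : EReal => c + (ρ : ℝ) :=
    continuous_iff_continuousAt.mpr fun c =>
      (EReal.continuousAt_add (p := (c, ((ρ : ℝ) : EReal))) (by simp) (by simp)).comp
        (f := fun c : EReal => (c, ((ρ : ℝ) : EReal))) (Continuous.prodMk_left _).continuousAt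
  refine lowerSemicontinuous_lintegral _ (fun u => ?_) fun θ =>
    (hadd.measurable.comp (measurable_conjugate_comp hφ θ.1)).ereal_toENNReal
  have hconj : LowerSemicontinuous fun θ : Feasible L ρ => conjugate θ.1 (φ u) := by
    refine lowerSemicontinuous_iSup fun s =>
      (continuous_coe_real_ereal.comp ?_).lowerSemicontinuous
    exact continuous_const.sub ((continuous_eval_const s).comp continuous_subtype_val)
  exact (EReal.continuous_toENNReal.comp hadd).comp_lowerSemicontinuous hconj fun a b h =>
    EReal.toENNReal_le_toENNReal (add_le_add_left h _)

/-- If the inner value is a lower semicontinuous function of the feasible function, then the outer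
problem has a minimizer. -/
theorem exists_outer_minimizer {φ : I → ℝ≥0} (hφ : Monotone φ) (L ρ : ℝ≥0)
    (J : (ℝ → ℝ) → ℝ≥0∞) (hJ : LowerSemicontinuous fun θ : Feasible L ρ => J θ.1) :
    ∃ g ∈ feasible L ρ, ∀ h ∈ feasible L ρ, outerObjective J φ g ≤ outerObjective J φ h := by
  obtain ⟨θ, -, hmin⟩ := ((hJ.add (lowerSemicontinuous_lintegral_conjugate hφ L ρ)
    ).lowerSemicontinuousOn Set.univ).exists_isMinOn
      ⟨⟨⟨_, continuous_const⟩, zero_mem_feasible L ρ⟩, Set.mem_univ _⟩ isCompact_univ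
  refine ⟨θ.1, θ.2, fun h hh => ?_⟩
  rw [outerObjective_eq hφ J θ.2, outerObjective_eq hφ J hh]
  refine EReal.sub_le_sub (EReal.coe_ennreal_le_coe_ennreal_iff.mpr ?_) le_rfl
  exact hmin (Set.mem_univ (⟨⟨h, hh.2.2.1.continuous⟩, hh⟩ : Feasible L ρ))

theorem continuous_feasible_eval (L ρ : ℝ≥0) :
    Continuous fun q : Feasible L ρ × ℝ => q.1.1 q.2 :=
  continuous_eval.comp (f := fun q : Feasible L ρ × ℝ => (q.1.1, q.2)) (by fun_prop)

end SpectralMDP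

end

/-! ### Existence of a minimizer in both cases -/

theorem theorem7p5 {E A 𝒵 Ω : Type*}
    [TopologicalSpace E] [TopologicalSpace.MetrizableSpace E] [SecondCountableTopology E]
    [MeasurableSpace E] [BorelSpace E] [StandardBorelSpace E]
    [TopologicalSpace A] [TopologicalSpace.MetrizableSpace A] [SecondCountableTopology A]
    [MeasurableSpace A] [BorelSpace A] [StandardBorelSpace A]
    [MeasurableSpace 𝒵] [MeasurableSpace Ω] (P : Measure Ω) [IsProbabilityMeasure P]
    (Z : ℕ → Ω → 𝒵) (hZ : ∀ n, Measurable (Z n)) (hindep : iIndepFun Z P)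
    (β : {t : ℝ≥0 // 0 < t}) (φ : I → ℝ≥0) (hφ : SpectralMDP.IsSpectrum φ) (ρ : ℝ≥0) (x : E) :
    (∀ (N : ℕ) (M : ℕ → SpectralMDP.Stage E A 𝒵) (cN : E → ℝ≥0),
      (∀ n < N, (M n).Regular) → LowerSemicontinuous cN →
      ∃ g ∈ SpectralMDP.feasible (φ 1) ρ,
        ∀ h ∈ SpectralMDP.feasible (φ 1) ρ,
          SpectralMDP.outerObjective
              (fun f => SpectralMDP.valueFin P M cN β Z N f (x, 0, ⟨1, one_pos⟩)) φ g ≤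
            SpectralMDP.outerObjective
              (fun f => SpectralMDP.valueFin P M cN β Z N f (x, 0, ⟨1, one_pos⟩)) φ h) ∧
    (∀ S : SpectralMDP.Stage E A 𝒵, S.Regular → (∀ n, IdentDistrib (Z n) (Z 0) P P) →
      ∃ g ∈ SpectralMDP.feasible (φ 1) ρ,
        ∀ h ∈ SpectralMDP.feasible (φ 1) ρ,
          SpectralMDP.outerObjective
              (fun f => SpectralMDP.valueInf P S β Z f (x, 0, ⟨1, one_pos⟩)) φ g ≤
            SpectralMDP.outerObjective
              (fun f => SpectralMDP.valueInf P S β Z f (x, 0, ⟨1, one_pos⟩)) φ h) := by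

  have hG := SpectralMDP.continuous_feasible_eval (φ 1) ρ
  have hmono : ∀ θ : SpectralMDP.Feasible (φ 1) ρ, Monotone θ.1 := fun θ => θ.2.1
  refine ⟨fun N M cN hM hcN => ?_, fun S hS hid => ?_⟩
  · refine SpectralMDP.exists_outer_minimizer hφ.monotone _ _ _ ?_
    -- The inner value is now jointly lower semicontinuous in `θ` and the extended state; restrict
    -- it to the fixed initial state.
    simp_rw [SpectralMDP.valueFin_eq_backward hZ hindep hM hcN hG hmono]
    exact ((SpectralMDP.SemicontinuousMonotone.terminalValue hcN hG hmono).backward hM β _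
      le_rfl).lsc.comp (Continuous.prodMk_left _)
  · refine SpectralMDP.exists_outer_minimizer hφ.monotone _ _ _ ?_
    simp_rw [SpectralMDP.valueInf_eq_iSup hZ hindep hid hS hG hmono]
    exact (SpectralMDP.SemicontinuousMonotone.iSup
      ((SpectralMDP.SemicontinuousMonotone.terminalValue (E := E) (cN := 0)
        lowerSemicontinuous_const hG hmono).iterate_bellman hS β _)).lsc.comp
      (Continuous.prodMk_left _)
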